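/- Let $T_{\mathbb Z}$ be the complete first-order theory of the structure $\langle\mathbb R;+,<,\mathbb Z\rangle$, in the language with a binary function symbol $+$, a binary relation symbol $<$ and a unary predicate for $\mathbb Z$. Let $\mathcal M=\langle M;+,<,Z\rangle$ be any model of $T_{\mathbb Z}$. Then $M$ has a neutral element $0$ for $+$, the set $\{z\in Z: z>0\}$ has a least element, denoted $1$, and $Z$ is closed under $+$, so that $\langle Z;+,<\rangle$ is a structure. Intervals are taken in $M$, and "definable" means first-order definable with parameters from the structure in question. If $X\subseteq M$ is definable in $\mathcal M$, then $X$ is a finite union of sets, each of which has one of the following two forms: - $\bigcup_{w\in W}\{w+\lambda\}$, where $W\subseteq Z$ is definable in $\langle Z;+,<\rangle$ and $\lambda\in[0,1)$; - $\bigcup_{w\in W}(w+\lambda_0,\,w+\lambda_1)$, where $W\subseteq Z$ is definable in $\langle Z;+,<\rangle$, $\lambda_0,\lambda_1\in[0,1]$ and $\lambda_0<\lambda_1$. -/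

import Mathlib

open FirstOrder

universe u

/-- Function symbols of the languages used below: one binary symbol `+`. -/
inductive AddFunc : ℕ → Type
  | add : AddFunc 2

/-- Relation symbols of the language `{+, <}`: one binary symbol `<`. -/
inductive OrdRel : ℕ → Type
  | lt : OrdRel 2

/-- Relation symbols of the language `{+, <, Z}`: a binary symbol `<` and a unary symbol `Z`. -/
inductive OrdPredRel : ℕ → Type
  | lt : OrdPredRel 2
  | pred : OrdPredRel 1

/-- The language `{+, <}`. -/
def LAddOrd : FirstOrder.Language.{0, 0} := ⟨AddFunc, OrdRel⟩

/-- The language `{+, <, Z}` with `Z` a unary predicate. -/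
def LAddOrdPred : FirstOrder.Language.{0, 0} := ⟨AddFunc, OrdPredRel⟩

/-- The structure `⟨A; +, <⟩`. -/
@[reducible] def addOrdStructure (A : Type u) [Add A] [LT A] : LAddOrd.Structure A where
  funMap := fun f => match f with
    | AddFunc.add => fun v => v 0 + v 1
  RelMap := fun r => match r with
    | OrdRel.lt => fun v => v 0 < v 1

/-- The structure `⟨M; +, <, Z⟩`. -/
@[reducible] def addOrdPredStructure (M : Type u) [Add M] [LT M] (Z : Set M) :
    LAddOrdPred.Structure M where
  funMap := fun f => match f with
    | AddFunc.add => fun v => v 0 + v 1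
  RelMap := fun r => match r with
    | OrdPredRel.lt => fun v => v 0 < v 1
    | OrdPredRel.pred => fun v => v 0 ∈ Z

/-- `T_ℤ`, the complete first-order theory of `⟨ℝ; +, <, ℤ⟩`. -/
def theoryRealInt : LAddOrdPred.Theory :=
  letI := addOrdPredStructure ℝ (Set.range ((↑) : ℤ → ℝ))
  LAddOrdPred.completeTheory ℝ

/-- `⟨M; +, <, Z⟩ ⊨ T_ℤ`. -/
def ModelsRealInt (M : Type u) [Add M] [LT M] (Z : Set M) : Prop :=
  letI := addOrdPredStructure M Z
  M ⊨ theoryRealInt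

/-- `X ⊆ M` is definable, with parameters from `M`, in `⟨M; +, <, Z⟩`. -/
def DefinableAddOrdPred {M : Type u} [Add M] [LT M] (Z : Set M) (X : Set M) : Prop :=
  letI := addOrdPredStructure M Z
  (Set.univ : Set M).Definable₁ LAddOrdPred X

/-- `W ⊆ A` is definable, with parameters from `A`, in `⟨A; +, <⟩`. -/
def DefinableAddOrd {A : Type u} [Add A] [LT A] (W : Set A) : Prop :=
  letI := addOrdStructure A
  (Set.univ : Set A).Definable₁ LAddOrd W

/-- `o` is the neutral element of `M`. -/
def IsNeutral {M : Type u} [Add M] (o : M) : Prop :=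
  ∀ x : M, o + x = x ∧ x + o = x

/-- `e` is the least element of `Z` that is greater than `o`. With `o = 0` this is the element
called `1` of a model `⟨M; +, <, Z⟩` of `T_ℤ`. -/
def IsLeastAbove {M : Type u} [LT M] (Z : Set M) (o e : M) : Prop :=
  e ∈ Z ∧ o < e ∧ ∀ z ∈ Z, o < z → e = z ∨ e < z

/-- Sets `⋃_{w ∈ W} {w + l}` with `W` definable in `⟨S; +, <⟩` and `l ∈ [o, e)`. -/
def IsTranslatePoints {M : Type u} [Add M] [LT M] (S : AddSubsemigroup M) (o e : M)
    (Y : Set M) : Prop :=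
  ∃ (W : Set S) (l : M), DefinableAddOrd W ∧ (o = l ∨ o < l) ∧ l < e ∧
    Y = ⋃ w ∈ W, {(w : M) + l}

/-- Sets `⋃_{w ∈ W} (w + l₀, w + l₁)` with `W` definable in `⟨S; +, <⟩`, `l₀ < l₁` and
`l₀, l₁ ∈ [o, e]`. -/
def IsTranslateIntervals {M : Type u} [Add M] [LT M] (S : AddSubsemigroup M) (o e : M)
    (Y : Set M) : Prop :=
  ∃ (W : Set S) (l₀ l₁ : M), DefinableAddOrd W ∧ l₀ < l₁ ∧
    (o = l₀ ∨ o < l₀) ∧ (l₀ = e ∨ l₀ < e) ∧ (o = l₁ ∨ o < l₁) ∧ (l₁ = e ∨ l₁ < e) ∧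
    Y = ⋃ w ∈ W, {x : M | (w : M) + l₀ < x ∧ x < (w : M) + l₁}

/-! Every element of `M` is uniquely `w + r` with `w ∈ Z` and `0 ≤ r < 1`. Along this splitting a
term becomes a term in the integer parts plus an affine function of the fractional parts, and the
latter takes values in a bounded range, so its own integer part (the carry) has finitely many
possibilities. Splitting by the carry turns an atomic formula into a finite union of conditions
"integer parts in a set definable in `⟨Z; +, <⟩`, fractional parts in a semilinear set"
(`isDecomposable_term_lt`, `isDecomposable_term_mem`).

Such unions are closed under Boolean operations. They are closed under projection because integer
and fractional parts can be chosen independently: on the integer side a projection of a definable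
set is definable, with no quantifier elimination needed, and on the fractional side Fourier–Motzkin
elimination applies (`IsSemilinear.image_comp`). In one variable a semilinear set is cut out by
finitely many breakpoints, which yields the points and intervals.

All that is used of the theory is a finite list of axioms together with divisibility, both inherited
from `ℝ`. -/

open FirstOrder.Language

/-! ### Transfer of first-order axioms from `ℝ` to `M`. -/

/-- First-order axioms satisfied by `⟨ℝ; +, <, ℤ⟩`, apart from divisibility. -/
structure IntegerPartAxioms (A : Type u) [Add A] [LT A] (Z : Set A) (o e : A) : Prop where
  assoc : ∀ x y z : A, x + y + z = x + (y + z)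
  comm : ∀ x y : A, x + y = y + x
  irrefl : ∀ x : A, ¬ x < x
  trans : ∀ x y z : A, x < y → y < z → x < z
  total : ∀ x y : A, x < y ∨ x = y ∨ y < x
  add_lt : ∀ x y z : A, x < y → x + z < y + z
  zero_add : ∀ x : A, o + x = x
  exists_neg : ∀ x : A, ∃ y : A, x + y = o
  zero_mem : o ∈ Z
  one_mem : e ∈ Z
  zero_lt_one : o < e
  least : ∀ z : A, z ∈ Z → o < z → e = z ∨ e < z
  add_mem : ∀ x y : A, x ∈ Z → y ∈ Z → x + y ∈ Z
  neg_mem : ∀ x y : A, x ∈ Z → x + y = o → y ∈ Z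
  exists_floor : ∀ x : A, ∃ z : A, z ∈ Z ∧ ¬ x < z ∧ x < z + e

namespace LAddOrdPred

/-- The term `s + t`. -/
def addTerm {α : Type} (s t : LAddOrdPred.Term α) : LAddOrdPred.Term α :=
  Functions.apply₂ (L := LAddOrdPred) AddFunc.add s t

/-- The formula `s < t`. -/
def ltFormula {α : Type} {n : ℕ} (s t : LAddOrdPred.Term (α ⊕ Fin n)) :
    LAddOrdPred.BoundedFormula α n :=
  Relations.boundedFormula₂ (L := LAddOrdPred) OrdPredRel.lt s t

/-- The formula `t ∈ Z`. -/
def predFormula {α : Type} {n : ℕ} (t : LAddOrdPred.Term (α ⊕ Fin n)) :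
    LAddOrdPred.BoundedFormula α n :=
  Relations.boundedFormula₁ (L := LAddOrdPred) OrdPredRel.pred t

/-- The term `x + ⋯ + x` with `n + 1` summands. -/
def multipleTerm {α : Type} (x : LAddOrdPred.Term α) : ℕ → LAddOrdPred.Term α
  | 0 => x
  | n + 1 => addTerm (multipleTerm x n) x

section Realize

variable {A : Type u} [Add A] [LT A] (Z : Set A)

theorem realize_addTerm {α : Type} (s t : LAddOrdPred.Term α) (v : α → A) :
    letI := addOrdPredStructure A Z
    (addTerm s t).realize v = s.realize v + t.realize v :=
  rfl

theorem realize_ltFormula {α : Type} {n : ℕ} (s t : LAddOrdPred.Term (α ⊕ Fin n))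
    (v : α → A) (xs : Fin n → A) :
    letI := addOrdPredStructure A Z
    (ltFormula s t).Realize v xs ↔
      s.realize (Sum.elim v xs) < t.realize (Sum.elim v xs) :=
  Iff.rfl

theorem realize_predFormula {α : Type} {n : ℕ} (t : LAddOrdPred.Term (α ⊕ Fin n))
    (v : α → A) (xs : Fin n → A) :
    letI := addOrdPredStructure A Z
    (predFormula t).Realize v xs ↔ t.realize (Sum.elim v xs) ∈ Z :=
  Iff.rfl

end Realize

/-- The sentence expressing that `IntegerPartAxioms` holds for some `o` and `e`. -/
def integerPartSentence : LAddOrdPred.Sentence :=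
  -- `&0` is the neutral element and `&1` the unit; the inner quantifiers bind from `&2` on.
  ∃' ∃' (
    (∀' ∀' ∀' (addTerm (addTerm (&2) (&3)) (&4) =' addTerm (&2) (addTerm (&3) (&4)))) ⊓
    ((∀' ∀' (addTerm (&2) (&3) =' addTerm (&3) (&2))) ⊓
    ((∀' ∼(ltFormula (&2) (&2))) ⊓
    ((∀' ∀' ∀' (ltFormula (&2) (&3) ⟹ (ltFormula (&3) (&4) ⟹ ltFormula (&2) (&4)))) ⊓
    ((∀' ∀' (ltFormula (&2) (&3) ⊔ (((&2) =' (&3)) ⊔ ltFormula (&3) (&2)))) ⊓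
    ((∀' ∀' ∀' (ltFormula (&2) (&3) ⟹ ltFormula (addTerm (&2) (&4)) (addTerm (&3) (&4)))) ⊓
    ((∀' (addTerm (&0) (&2) =' (&2))) ⊓
    ((∀' ∃' (addTerm (&2) (&3) =' (&0))) ⊓
    (predFormula (&0) ⊓
    (predFormula (&1) ⊓
    (ltFormula (&0) (&1) ⊓
    ((∀' (predFormula (&2) ⟹ (ltFormula (&0) (&2) ⟹
      (((&1) =' (&2)) ⊔ ltFormula (&1) (&2))))) ⊓
    ((∀' ∀' (predFormula (&2) ⟹ (predFormula (&3) ⟹ predFormula (addTerm (&2) (&3))))) ⊓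
    ((∀' ∀' (predFormula (&2) ⟹ ((addTerm (&2) (&3) =' (&0)) ⟹ predFormula (&3)))) ⊓
    (∀' ∃' (predFormula (&3) ⊓ (∼(ltFormula (&2) (&3)) ⊓
      ltFormula (&2) (addTerm (&3) (&1)))))))))))))))))))

/-- The sentence expressing that every element is divisible by `n + 1`. -/
def divisibleSentence (n : ℕ) : LAddOrdPred.Sentence :=
  ∀' ∃' (multipleTerm (&1) n =' (&0))

theorem realize_integerPartSentence (A : Type u) [Add A] [LT A] (Z : Set A) :
    letI := addOrdPredStructure A Z
    A ⊨ integerPartSentence ↔ ∃ o e : A, IntegerPartAxioms A Z o e := by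
  let := addOrdPredStructure A Z
  have key : A ⊨ integerPartSentence ↔ ∃ o e : A,
      (∀ x y z : A, x + y + z = x + (y + z)) ∧ (∀ x y : A, x + y = y + x) ∧
      (∀ x : A, ¬ x < x) ∧ (∀ x y z : A, x < y → y < z → x < z) ∧
      (∀ x y : A, x < y ∨ x = y ∨ y < x) ∧ (∀ x y z : A, x < y → x + z < y + z) ∧
      (∀ x : A, o + x = x) ∧ (∀ x : A, ∃ y : A, x + y = o) ∧ o ∈ Z ∧ e ∈ Z ∧ o < e ∧
      (∀ z : A, z ∈ Z → o < z → e = z ∨ e < z) ∧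
      (∀ x y : A, x ∈ Z → y ∈ Z → x + y ∈ Z) ∧ (∀ x y : A, x ∈ Z → x + y = o → y ∈ Z) ∧
      ∀ x : A, ∃ z : A, z ∈ Z ∧ ¬ x < z ∧ x < z + e := by
    simp only [Sentence.Realize, Formula.Realize, integerPartSentence,
      BoundedFormula.realize_ex, BoundedFormula.realize_all, BoundedFormula.realize_inf,
      BoundedFormula.realize_sup, BoundedFormula.realize_imp, BoundedFormula.realize_not,
      BoundedFormula.realize_bdEqual, realize_ltFormula, realize_predFormula, realize_addTerm]
    exact Iff.rfl
  rw [key]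
  constructor
  · rintro ⟨o, e, h1, h2, h3, h4, h5, h6, h7, h8, h9, h10, h11, h12, h13, h14, h15⟩
    exact ⟨o, e, h1, h2, h3, h4, h5, h6, h7, h8, h9, h10, h11, h12, h13, h14, h15⟩
  · rintro ⟨o, e, h1, h2, h3, h4, h5, h6, h7, h8, h9, h10, h11, h12, h13, h14, h15⟩
    exact ⟨o, e, h1, h2, h3, h4, h5, h6, h7, h8, h9, h10, h11, h12, h13, h14, h15⟩

end LAddOrdPred

open LAddOrdPred

/-- The sum `x + ⋯ + x` with `n + 1` summands. -/
def addMultiple {A : Type u} [Add A] (x : A) : ℕ → A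
  | 0 => x
  | n + 1 => addMultiple x n + x

theorem addMultiple_eq_nsmul {A : Type u} [AddMonoid A] (x : A) (n : ℕ) :
    addMultiple x n = (n + 1) • x := by
  induction n with
  | zero => simp [addMultiple]
  | succ n ih => rw [addMultiple, ih, succ_nsmul x (n + 1)]

theorem LAddOrdPred.realize_divisibleSentence (A : Type u) [Add A] [LT A] (Z : Set A) (n : ℕ) :
    letI := addOrdPredStructure A Z
    A ⊨ divisibleSentence n ↔ ∀ x : A, ∃ y : A, addMultiple y n = x := by
  let := addOrdPredStructure A Z
  have key : ∀ (k : ℕ) (t : LAddOrdPred.Term (Empty ⊕ Fin 2)) (v : Empty ⊕ Fin 2 → A),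
      (multipleTerm t k).realize v = addMultiple (t.realize v) k := by
    intro k t v
    induction k with
    | zero => rfl
    | succ k ih => rw [multipleTerm, realize_addTerm, ih, addMultiple]
  simp only [Sentence.Realize, Formula.Realize, divisibleSentence,
    BoundedFormula.realize_ex, BoundedFormula.realize_all, BoundedFormula.realize_bdEqual, key]
  exact Iff.rfl

theorem integerPartAxioms_real :
    IntegerPartAxioms ℝ (Set.range ((↑) : ℤ → ℝ)) 0 1 where
  assoc := add_assoc
  comm := add_comm
  irrefl := lt_irrefl
  trans _ _ _ := lt_trans
  total := lt_trichotomy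
  add_lt _ _ z h := by linarith
  zero_add := zero_add
  exists_neg x := ⟨-x, by simp⟩
  zero_mem := ⟨0, by simp⟩
  one_mem := ⟨1, by simp⟩
  zero_lt_one := one_pos
  least := by
    rintro _ ⟨z, rfl⟩ h
    rw [← le_iff_eq_or_lt]
    exact_mod_cast h
  add_mem := by
    rintro _ _ ⟨x, rfl⟩ ⟨y, rfl⟩
    exact ⟨x + y, by simp⟩
  neg_mem := by
    rintro _ y ⟨x, rfl⟩ h
    exact ⟨-x, by push_cast; linarith⟩
  exists_floor x := ⟨⌊x⌋, ⟨_, rfl⟩, not_lt.2 (Int.floor_le x), Int.lt_floor_add_one x⟩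

theorem ModelsRealInt.realize_sentence {M : Type u} [Add M] [LT M] {Z : Set M}
    (hM : ModelsRealInt M Z) {φ : LAddOrdPred.Sentence}
    (hφ : letI := addOrdPredStructure ℝ (Set.range ((↑) : ℤ → ℝ)); ℝ ⊨ φ) :
    letI := addOrdPredStructure M Z
    M ⊨ φ := by
  let := addOrdPredStructure M Z
  have : M ⊨ theoryRealInt := hM
  exact Theory.realize_sentence_of_mem theoryRealInt hφ

theorem ModelsRealInt.exists_integerPartAxioms {M : Type u} [Add M] [LT M] {Z : Set M}
    (hM : ModelsRealInt M Z) : ∃ o e : M, IntegerPartAxioms M Z o e := by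
  rw [← realize_integerPartSentence]
  refine hM.realize_sentence ?_
  rw [realize_integerPartSentence]
  exact ⟨0, 1, integerPartAxioms_real⟩

theorem ModelsRealInt.exists_addMultiple_eq {M : Type u} [Add M] [LT M] {Z : Set M}
    (hM : ModelsRealInt M Z) (n : ℕ) (x : M) : ∃ y : M, addMultiple y n = x := by
  revert x
  rw [← realize_divisibleSentence M Z]
  refine hM.realize_sentence ?_
  rw [realize_divisibleSentence]
  intro x
  refine ⟨x / (n + 1), ?_⟩
  rw [addMultiple_eq_nsmul, nsmul_eq_mul]
  push_cast
  field_simp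

/-! ### Semilinear sets and Fourier–Motzkin elimination. -/

section Semilinear

variable {M : Type u} [AddCommGroup M] {α β : Type}

/-- Integral affine functions in the coordinates indexed by `α`. -/
inductive IsAffine : ((α → M) → M) → Prop
  | const (c : M) : IsAffine fun _ => c
  | proj (i : α) : IsAffine fun x => x i
  | add {f g : (α → M) → M} : IsAffine f → IsAffine g → IsAffine fun x => f x + g x
  | neg {f : (α → M) → M} : IsAffine f → IsAffine fun x => -f x

theorem IsAffine.sub {f g : (α → M) → M} (hf : IsAffine f) (hg : IsAffine g) :
    IsAffine fun x => f x - g x := by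
  simpa only [sub_eq_add_neg] using hf.add hg.neg

theorem IsAffine.nsmul {f : (α → M) → M} (hf : IsAffine f) (n : ℕ) :
    IsAffine fun x => n • f x := by
  induction n with
  | zero => simpa using IsAffine.const (0 : M)
  | succ n ih => simpa only [succ_nsmul] using ih.add hf

theorem IsAffine.zsmul {f : (α → M) → M} (hf : IsAffine f) (n : ℤ) :
    IsAffine fun x => n • f x := by
  cases n with
  | ofNat n => simpa using hf.nsmul n
  | negSucc n => simpa only [negSucc_zsmul] using (hf.nsmul (n + 1)).neg

/-- An affine function is affine in all coordinates but one, plus a multiple of that one. -/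
theorem IsAffine.exists_eq_add_zsmul {g : (β → M) → M} (hg : IsAffine g) (f : α → β) (b : β)
    (hfb : ∀ i, i = b ∨ i ∈ Set.range f) :
    ∃ (a : (α → M) → M) (n : ℤ), IsAffine a ∧ ∀ y, g y = a (y ∘ f) + n • y b := by
  induction hg with
  | const c => exact ⟨fun _ => c, 0, .const c, by simp⟩
  | proj i =>
    rcases hfb i with rfl | ⟨j, rfl⟩
    · exact ⟨fun _ => 0, 1, .const 0, by simp⟩
    · exact ⟨fun x => x j, 0, .proj j, by simp⟩
  | add _ _ ih₁ ih₂ =>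
    obtain ⟨a, n, ha, h⟩ := ih₁
    obtain ⟨a', n', ha', h'⟩ := ih₂
    refine ⟨_, n + n', ha.add ha', fun y => ?_⟩
    simp only [h, h', add_zsmul]
    abel
  | neg _ ih =>
    obtain ⟨a, n, ha, h⟩ := ih
    refine ⟨_, -n, ha.neg, fun y => ?_⟩
    simp only [h, neg_zsmul]
    abel

variable [LinearOrder M]

/-- Sets whose membership depends on the signs of finitely many affine functions. -/
def IsSemilinear (V : Set (α → M)) : Prop :=
  ∃ A : Set ((α → M) → M), A.Finite ∧ (∀ f ∈ A, IsAffine f) ∧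
    ∀ x y, (∀ f ∈ A, 0 < f x ↔ 0 < f y) → (x ∈ V ↔ y ∈ V)

theorem IsAffine.isSemilinear_pos {f : (α → M) → M} (hf : IsAffine f) :
    IsSemilinear {x | 0 < f x} :=
  ⟨{f}, Set.finite_singleton f, by simpa using hf, fun x y h => h f rfl⟩

theorem IsSemilinear.compl {V : Set (α → M)} (hV : IsSemilinear V) : IsSemilinear Vᶜ := by
  obtain ⟨A, hA, hA', h⟩ := hV
  exact ⟨A, hA, hA', fun x y hxy => not_congr (h x y hxy)⟩

theorem IsSemilinear.univ : IsSemilinear (Set.univ : Set (α → M)) :=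
  ⟨∅, Set.finite_empty, by simp, by simp⟩

theorem IsSemilinear.iInter {K : Type} [Finite K] {V : K → Set (α → M)}
    (hV : ∀ k, IsSemilinear (V k)) : IsSemilinear (⋂ k, V k) := by
  choose A hA hA' h using hV
  refine ⟨⋃ k, A k, Set.finite_iUnion hA, ?_, ?_⟩
  · intro f hf
    obtain ⟨k, hk⟩ := Set.mem_iUnion.1 hf
    exact hA' k f hk
  · intro x y hxy
    simp only [Set.mem_iInter]
    exact forall_congr' fun k => h k x y fun f hf => hxy f (Set.mem_iUnion.2 ⟨k, hf⟩)

theorem IsSemilinear.inter {V V' : Set (α → M)} (hV : IsSemilinear V) (hV' : IsSemilinear V') :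
    IsSemilinear (V ∩ V') := by
  rw [Set.inter_eq_iInter]
  have : ∀ b : Bool, IsSemilinear (cond b V V') := by rintro (_ | _) <;> assumption
  exact IsSemilinear.iInter this

variable [IsOrderedAddMonoid M]

theorem IsAffine.isSemilinear_nonneg {f : (α → M) → M} (hf : IsAffine f) :
    IsSemilinear {x | 0 ≤ f x} := by
  convert hf.neg.isSemilinear_pos.compl using 1
  ext x
  simp

theorem IsAffine.isSemilinear_eq_zero {f : (α → M) → M} (hf : IsAffine f) :
    IsSemilinear {x | f x = 0} := by
  convert hf.isSemilinear_nonneg.inter hf.neg.isSemilinear_nonneg using 1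
  ext x
  simp only [Set.mem_ofPred_eq, Set.mem_inter_iff, Left.nonneg_neg_iff]
  exact ⟨fun h => ⟨h.ge, h.le⟩, fun h => le_antisymm h.2 h.1⟩

theorem zsmul_pos_iff_of_pos {n : ℤ} (hn : 0 < n) (x : M) : 0 < n • x ↔ 0 < x := by
  simpa using zsmul_lt_zsmul_iff_right hn (a := 0) (b := x)

theorem zsmul_pos_iff_of_neg {n : ℤ} (hn : n < 0) (x : M) : 0 < n • x ↔ x < 0 := by
  have := zsmul_pos_iff_of_pos (neg_pos.2 hn) (-x)
  simpa using this

/-- The sign of `a + n • t` is determined by the position of `t` relative to the root. -/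
theorem add_zsmul_pos_iff {a p : M} {n : ℤ} (hp : n ≠ 0 → n • p = -a) (t : M) :
    0 < a + n • t ↔ (n = 0 ∧ 0 < a) ∨ (0 < n ∧ p < t) ∨ (n < 0 ∧ t < p) := by
  rcases lt_trichotomy n 0 with hn | rfl | hn
  · have h : a + n • t = n • (t - p) := by rw [zsmul_sub, hp hn.ne]; abel
    rw [h, zsmul_pos_iff_of_neg hn]
    simp [hn, hn.ne, hn.not_gt]
  · simp
  · have h : a + n • t = n • (t - p) := by rw [zsmul_sub, hp hn.ne']; abel
    rw [h, zsmul_pos_iff_of_pos hn]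
    simp [hn, hn.ne', hn.not_gt]

/-- A map defined on finitely many points with values in a dense order, which preserves the order
of these points, extends to any further point. -/
theorem exists_same_position {N : Type*} [LinearOrder N] [Nonempty N]
    [DenselyOrdered N] [NoMinOrder N] [NoMaxOrder N] {ι : Type*} {A : Set ι} (hA : A.Finite) (p q : ι → N)
    (hpq : ∀ i ∈ A, ∀ j ∈ A, p i < p j ↔ q i < q j) (t : N) :
    ∃ s, ∀ i ∈ A, (p i < t ↔ q i < s) ∧ (t < p i ↔ s < q i) := by
  classical
  by_cases ht : ∃ i ∈ A, p i = t
  -- If `t` is one of the points, its counterpart works; otherwise density and the absence of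
  -- endpoints give a value between the images of the points below and above `t`.
  · obtain ⟨i, hi, rfl⟩ := ht
    exact ⟨q i, fun j hj => ⟨hpq j hj i hi, hpq i hi j hj⟩⟩
  · push Not at ht
    obtain ⟨s, hs, hs'⟩ := Order.exists_between_finsets
      ((hA.toFinset.filter fun i => p i < t).image q)
      ((hA.toFinset.filter fun i => t < p i).image q) (by
        intro x hx y hy
        simp only [Finset.mem_image, Finset.mem_filter, Set.Finite.mem_toFinset] at hx hy
        obtain ⟨i, ⟨hi, hit⟩, rfl⟩ := hx
        obtain ⟨j, ⟨hj, hjt⟩, rfl⟩ := hy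
        exact (hpq i hi j hj).1 (hit.trans hjt))
    simp only [Finset.mem_image, Finset.mem_filter, Set.Finite.mem_toFinset,
      forall_exists_index, and_imp] at hs hs'
    refine ⟨s, fun i hi => ?_⟩
    rcases lt_or_gt_of_ne (ht i hi) with h | h
    · have := hs _ i hi h rfl
      simp [h, this, h.not_gt, this.not_gt]
    · have := hs' _ i hi h rfl
      simp [h, this, h.not_gt, this.not_gt]

/-- Fourier–Motzkin elimination. Over a base point, each function is `a + n • t` in the eliminated
coordinate `t`, so its sign is governed by the position of `t` relative to its root. Hence the fibre
over a base point is nonempty or not according to the signs of the functions `a` and the order of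
the roots. -/
theorem IsSemilinear.image_comp [DenselyOrdered M] [NoMinOrder M] [NoMaxOrder M]
    (hdiv : ∀ (n : ℤ) (x : M), n ≠ 0 → ∃ y, n • y = x)
    {V : Set (β → M)} (hV : IsSemilinear V) (f : α → β) (b : β)
    (hf : Function.Injective f) (hb : b ∉ Set.range f) (hfb : ∀ i, i = b ∨ i ∈ Set.range f) :
    IsSemilinear ((fun y : β → M => y ∘ f) '' V) := by
  obtain ⟨A, hA, hA', hV⟩ := hV
  have := hA.to_subtype
  choose a n ha h using fun g : A => (hA' g g.2).exists_eq_add_zsmul f b hfb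
  -- There is no root to choose when `n g = 0`; the value `0` is then a dummy.
  have hroot : ∀ (g : A) (x : α → M), ∃ p, n g ≠ 0 → n g • p = -a g x := by
    intro g x
    by_cases hn : n g = 0
    · exact ⟨0, fun h => absurd hn h⟩
    · obtain ⟨p, hp⟩ := hdiv (n g) (-a g x) hn
      exact ⟨p, fun _ => hp⟩
  choose p hp using hroot
  -- Cross-multiplied difference of two roots: it avoids division, so it is an integral affine
  -- function, and its sign still determines the order of the roots.
  let d : A → A → (α → M) → M := fun i j x => n j • a i x - n i • a j x
  have hd : ∀ i j x, n i ≠ 0 → n j ≠ 0 → d i j x = (n i * n j) • (p j x - p i x) := by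
    intro i j x hi hj
    rw [zsmul_sub, mul_zsmul, hp j x hj, mul_comm, mul_zsmul, hp i x hi]
    simp only [d, zsmul_neg]
    abel
  have key : ∀ x x' : α → M, (∀ g, 0 < a g x ↔ 0 < a g x') →
      (∀ i j, 0 < d i j x ↔ 0 < d i j x') →
      x ∈ (fun y : β → M => y ∘ f) '' V → x' ∈ (fun y : β → M => y ∘ f) '' V := by
    rintro _ x' h₁ h₂ ⟨y, hy, rfl⟩
    obtain ⟨s, hs⟩ := exists_same_position (A := {g : A | n g ≠ 0}) (Set.toFinite _)
      (fun g => p g (y ∘ f)) (fun g => p g x') (by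
        intro i hi j hj
        -- A negative product of coefficients reverses the comparison of roots, hence the swapped
        -- indices.
        rcases lt_or_gt_of_ne (mul_ne_zero hi hj) with hij | hij
        · have := h₂ j i
          rwa [hd j i _ hj hi, hd j i _ hj hi, mul_comm, zsmul_pos_iff_of_neg hij,
            zsmul_pos_iff_of_neg hij, sub_neg, sub_neg] at this
        · have := h₂ i j
          rwa [hd i j _ hi hj, hd i j _ hi hj, zsmul_pos_iff_of_pos hij,
            zsmul_pos_iff_of_pos hij, sub_pos, sub_pos] at this) (y b)
    refine ⟨Function.extend f x' fun _ => s, ?_, Function.extend_comp hf _ _⟩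
    refine (hV y _ fun g hg => ?_).1 hy
    have e₁ := h ⟨g, hg⟩ y
    have e₂ := h ⟨g, hg⟩ (Function.extend f x' fun _ => s)
    rw [Function.extend_comp hf, Function.extend_apply' _ _ _ hb] at e₂
    simp only at e₁ e₂
    rw [e₁, e₂, add_zsmul_pos_iff (hp ⟨g, hg⟩ _), add_zsmul_pos_iff (hp ⟨g, hg⟩ _), h₁]
    have hs' := hs ⟨g, hg⟩
    simp only [Set.mem_ofPred_eq] at hs'
    refine or_congr Iff.rfl (or_congr ?_ ?_)
    · exact and_congr_right fun hn => (hs' hn.ne').1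
    · exact and_congr_right fun hn => (hs' hn.ne).2
  refine ⟨Set.range a ∪ Set.range fun ij : A × A => d ij.1 ij.2,
    (Set.finite_range _).union (Set.finite_range _), ?_, ?_⟩
  · rintro _ (⟨g, rfl⟩ | ⟨⟨i, j⟩, rfl⟩)
    · exact ha g
    · exact ((ha i).zsmul _).sub ((ha j).zsmul _)
  · intro x x' hxx'
    have h₁ : ∀ g, 0 < a g x ↔ 0 < a g x' := fun g => hxx' _ (Or.inl ⟨g, rfl⟩)
    have h₂ : ∀ i j, 0 < d i j x ↔ 0 < d i j x' := fun i j => hxx' _ (Or.inr ⟨(i, j), rfl⟩)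
    exact ⟨key x x' h₁ h₂, key x' x (fun g => (h₁ g).symm) fun i j => (h₂ i j).symm⟩

/-- Membership in a semilinear subset of the line depends only on the position relative to
finitely many points. -/
theorem IsSemilinear.exists_finite_breakpoints
    (hdiv : ∀ (n : ℤ) (x : M), n ≠ 0 → ∃ y, n • y = x)
    {V : Set (β → M)} (hV : IsSemilinear V) (b : β) (hb : ∀ i, i = b) :
    ∃ P : Set M, P.Finite ∧ ∀ x y : β → M,
      (∀ p ∈ P, (p < x b ↔ p < y b) ∧ (x b < p ↔ y b < p)) → (x ∈ V ↔ y ∈ V) := by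
  obtain ⟨A, hA, hA', hV⟩ := hV
  have := hA.to_subtype
  -- With `b` the only coordinate, the base is indexed by `Empty`, so each `a g` amounts to a
  -- constant.
  choose a n ha h using fun g : A =>
    (hA' g g.2).exists_eq_add_zsmul (Empty.elim : Empty → β) b fun i => Or.inl (hb i)
  have hroot : ∀ g : A, ∃ p, n g ≠ 0 → n g • p = -a g Empty.elim := by
    intro g
    by_cases hn : n g = 0
    · exact ⟨0, fun h => absurd hn h⟩
    · obtain ⟨p, hp⟩ := hdiv (n g) (-a g Empty.elim) hn
      exact ⟨p, fun _ => hp⟩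
  choose p hp using hroot
  refine ⟨Set.range p, Set.finite_range p, fun x y hxy => hV x y fun g hg => ?_⟩
  have e : ∀ z : β → M, g z = a ⟨g, hg⟩ Empty.elim + n ⟨g, hg⟩ • z b := fun z => by
    rw [← Subsingleton.elim (z ∘ Empty.elim) Empty.elim]
    exact h ⟨g, hg⟩ z
  have hg' := hxy _ ⟨⟨g, hg⟩, rfl⟩
  rw [e, e, add_zsmul_pos_iff (hp _), add_zsmul_pos_iff (hp _), hg'.1, hg'.2]

end Semilinear

set_option linter.unusedSectionVars false

attribute [local instance] addOrdStructure

/-! ### Integer and fractional parts; decomposability of definable sets. -/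

section Decomposition

/-- The assignment of values to parameters, free variables and bound variables. -/
def parameterAssignment {α β : Type} {M : Type u} (x : α ⊕ β → M) :
    ((Set.univ : Set M) ⊕ α) ⊕ β → M :=
  Sum.elim (Sum.elim Subtype.val (x ∘ Sum.inl)) (x ∘ Sum.inr)

/-- Inequalities between terms of the language `{+, <}` define definable sets. -/
theorem definable_term_lt {A : Type u} {β : Type} [Add A] [LT A]
    (t s : LAddOrd.Term ((Set.univ : Set A) ⊕ β)) :
    (Set.univ : Set A).Definable LAddOrd
      {k : β → A | t.realize (Sum.elim (↑) k) < s.realize (Sum.elim (↑) k)} :=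
  Set.definable_iff_exists_formula_sum.2
    ⟨Relations.formula₂ (L := LAddOrd) OrdRel.lt t s, by
      ext
      rw [Set.mem_ofPred_eq, Set.mem_ofPred_eq]
      exact (Formula.realize_rel₂ (L := LAddOrd) (M := A) (R := OrdRel.lt)).symm⟩

variable {M : Type u} [AddCommGroup M] [LinearOrder M] [IsOrderedAddMonoid M]

theorem exists_nsmul_le_lt {e : M} (n : ℕ) {x : M} (hx : 0 ≤ x) (hxn : x < n • e) :
    ∃ i < n, i • e ≤ x ∧ x < (i + 1) • e := by
  induction n with
  | zero => exact absurd hxn (by simpa using hx)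
  | succ n ih =>
    by_cases hn : x < n • e
    · obtain ⟨i, hi, h'⟩ := ih hn
      exact ⟨i, by omega, h'⟩
    · exact ⟨n, by omega, not_lt.1 hn, hxn⟩

/-- `S` is a discrete subgroup with least positive element `e` in the divisible ordered group `M`,
and every element of `M` has an integer part in `S`. -/
structure HasIntegerPart (S : AddSubsemigroup M) (e : M) : Prop where
  zero_mem : 0 ∈ S
  neg_mem : ∀ z ∈ S, -z ∈ S
  one_mem : e ∈ S
  one_pos : 0 < e
  one_le : ∀ z ∈ S, 0 < z → e ≤ z
  exists_floor : ∀ x, ∃ z ∈ S, z ≤ x ∧ x < z + e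
  divisible : ∀ (n : ℤ) (x : M), n ≠ 0 → ∃ y, n • y = x

namespace HasIntegerPart

variable {S : AddSubsemigroup M} {e : M} (h : HasIntegerPart S e)

include h

theorem nsmul_mem (n : ℕ) : n • e ∈ S := by
  induction n with
  | zero => simpa using h.zero_mem
  | succ n ih => simpa only [succ_nsmul] using S.add_mem ih h.one_mem

theorem sub_mem {x y : M} (hx : x ∈ S) (hy : y ∈ S) : x - y ∈ S := by
  simpa only [sub_eq_add_neg] using S.add_mem hx (h.neg_mem y hy)

theorem add_one_le {x y : M} (hx : x ∈ S) (hy : y ∈ S) (hxy : x < y) : x + e ≤ y := by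
  have := h.one_le _ (h.sub_mem hy hx) (sub_pos.2 hxy)
  rwa [le_sub_iff_add_le'] at this

theorem densely : DenselyOrdered M := by
  refine ⟨fun a b hab => ?_⟩
  obtain ⟨y, hy⟩ := h.divisible 2 (b - a) two_ne_zero
  have hy0 : 0 < y := by
    rw [← zsmul_pos_iff_of_pos two_pos, hy]
    exact sub_pos.2 hab
  refine ⟨a + y, lt_add_of_pos_right a hy0, ?_⟩
  have : b = a + y + y := by
    rw [add_assoc, ← two_zsmul, hy]
    abel
  rw [this]
  exact lt_add_of_pos_right _ hy0

theorem nontrivial : Nontrivial M := ⟨0, e, h.one_pos.ne⟩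

/-- The integer part. -/
noncomputable def floor (x : M) : S :=
  ⟨(h.exists_floor x).choose, (h.exists_floor x).choose_spec.1⟩

/-- The fractional part. -/
noncomputable def fract (x : M) : M := x - h.floor x

theorem floor_add_fract (x : M) : (h.floor x : M) + h.fract x = x := by
  simp [fract]

theorem fract_nonneg (x : M) : 0 ≤ h.fract x :=
  sub_nonneg.2 (h.exists_floor x).choose_spec.2.1

theorem fract_lt (x : M) : h.fract x < e :=
  sub_lt_iff_lt_add'.2 (h.exists_floor x).choose_spec.2.2

/-- Uniqueness of the splitting: distinct elements of `S` differ by at least `e`, more than two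
fractional parts can. -/
theorem floor_add (k : S) {r : M} (hr : 0 ≤ r) (hre : r < e) : h.floor (k + r) = k := by
  have h₁ := h.floor_add_fract (k + r)
  have h₂ := h.fract_nonneg (k + r)
  have h₃ := h.fract_lt (k + r)
  rcases lt_trichotomy (h.floor (k + r) : M) k with hk | hk | hk
  · have := h.add_one_le (h.floor _).2 k.2 hk
    refine absurd h₁ (ne_of_lt ?_)
    calc (h.floor (k + r) : M) + h.fract (k + r) < h.floor (k + r) + e := by gcongr
      _ ≤ k := this
      _ ≤ k + r := le_add_of_nonneg_right hr
  · exact Subtype.ext hk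
  · have := h.add_one_le k.2 (h.floor _).2 hk
    refine absurd h₁ (ne_of_gt ?_)
    calc (k : M) + r < k + e := by gcongr
      _ ≤ h.floor (k + r) := this
      _ ≤ h.floor (k + r) + h.fract (k + r) := le_add_of_nonneg_right h₂

theorem fract_add (k : S) {r : M} (hr : 0 ≤ r) (hre : r < e) : h.fract (k + r) = r := by
  rw [fract, h.floor_add k hr hre]
  abel

variable {α β : Type} {γ : Type u}

/-- Finite unions of products of a definable set of integer parts and a semilinear set of
fractional parts. -/
def IsDecomposable (X : Set (α → M)) : Prop :=
  ∃ (K : Type) (_ : Finite K) (W : K → Set (α → S)) (V : K → Set (α → M)),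
    (∀ k, (Set.univ : Set S).Definable LAddOrd (W k)) ∧ (∀ k, IsSemilinear (V k)) ∧
    ∀ x, x ∈ X ↔ ∃ k, h.floor ∘ x ∈ W k ∧ h.fract ∘ x ∈ V k

theorem isDecomposable_empty : h.IsDecomposable (∅ : Set (α → M)) :=
  ⟨Empty, inferInstance, Empty.elim, Empty.elim, by simp, by simp, by simp⟩

theorem isDecomposable_fract {V : Set (α → M)} (hV : IsSemilinear V) :
    h.IsDecomposable {x | h.fract ∘ x ∈ V} :=
  ⟨Unit, inferInstance, fun _ => Set.univ, fun _ => V, fun _ => Set.definable_univ,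
    fun _ => hV, by simp⟩

theorem IsDecomposable.compl {X : Set (α → M)} (hX : h.IsDecomposable X) :
    h.IsDecomposable Xᶜ := by
  classical
  obtain ⟨K, hK, W, V, hW, hV, hX⟩ := hX
  -- De Morgan and distributivity: `T k` records whether the `k`-th product is left through its
  -- integral or its fractional factor.
  refine ⟨K → Bool, inferInstance, fun T => ⋂ k, cond (T k) (W k)ᶜ Set.univ,
    fun T => ⋂ k, cond (T k) Set.univ (V k)ᶜ, fun T => ?_, fun T => ?_, fun x => ?_⟩
  · refine Set.definable_iInter_of_finite fun k => ?_
    cases T k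
    · exact Set.definable_univ
    · exact (hW k).compl
  · refine IsSemilinear.iInter fun k => ?_
    cases T k
    · exact (hV k).compl
    · exact IsSemilinear.univ
  · rw [Set.mem_compl_iff, hX]
    simp only [Set.mem_iInter]
    constructor
    · intro hx
      refine ⟨fun k => decide (h.floor ∘ x ∉ W k), fun k => ?_, fun k => ?_⟩
      · by_cases hk : h.floor ∘ x ∈ W k <;> simp [hk]
      · by_cases hk : h.floor ∘ x ∈ W k
        · have : h.fract ∘ x ∉ V k := fun hv => hx ⟨k, hk, hv⟩
          simp [hk, this]
        · simp [hk]
    · rintro ⟨T, h₁, h₂⟩ ⟨k, h₃, h₄⟩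
      have h₁' := h₁ k
      have h₂' := h₂ k
      cases hT : T k
      · rw [hT] at h₂'
        exact h₂' h₄
      · rw [hT] at h₁'
        exact h₁' h₃

theorem IsDecomposable.iUnion {K : Type} [Finite K] {X : K → Set (α → M)}
    (hX : ∀ k, h.IsDecomposable (X k)) : h.IsDecomposable (⋃ k, X k) := by
  choose K' hK' W V hW hV hX using hX
  refine ⟨Σ k, K' k, inferInstance, fun k => W k.1 k.2, fun k => V k.1 k.2,
    fun k => hW k.1 k.2, fun k => hV k.1 k.2, fun x => ?_⟩
  simp only [Set.mem_iUnion, hX, Sigma.exists]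

theorem IsDecomposable.union {X Y : Set (α → M)} (hX : h.IsDecomposable X)
    (hY : h.IsDecomposable Y) : h.IsDecomposable (X ∪ Y) := by
  rw [Set.union_eq_iUnion]
  refine IsDecomposable.iUnion h fun b => ?_
  cases b
  · exact hY
  · exact hX

theorem IsDecomposable.inter {X Y : Set (α → M)} (hX : h.IsDecomposable X)
    (hY : h.IsDecomposable Y) : h.IsDecomposable (X ∩ Y) := by
  rw [← compl_compl (X ∩ Y), Set.compl_inter]
  exact ((hX.compl h).union h (hY.compl h)).compl h

/-- The integer and fractional parts of the eliminated coordinate vary independently, so the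
quantifier over it splits into one for each factor. -/
theorem IsDecomposable.image_comp [Finite α] [Finite β] {X : Set (β → M)}
    (hX : h.IsDecomposable X) (f : α → β) (b : β) (hf : Function.Injective f)
    (hb : b ∉ Set.range f) (hfb : ∀ i, i = b ∨ i ∈ Set.range f) :
    h.IsDecomposable ((fun y : β → M => y ∘ f) '' X) := by
  have := h.densely
  have := h.nontrivial
  obtain ⟨K, hK, W, V, hW, hV, hX⟩ := hX
  -- The eliminated coordinate is confined to `[0, e)` so that a witness on the fractional side is a
  -- genuine fractional part; the other coordinates come from `x`.
  have hb0 : IsSemilinear {y : β → M | 0 ≤ y b} := (IsAffine.proj b).isSemilinear_nonneg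
  have hbe : IsSemilinear {y : β → M | 0 < e - y b} :=
    ((IsAffine.const e).sub (IsAffine.proj b)).isSemilinear_pos
  refine ⟨K, hK, fun k => (fun y : β → S => y ∘ f) '' W k,
    fun k => (fun y : β → M => y ∘ f) '' (V k ∩ ({y | 0 ≤ y b} ∩ {y | 0 < e - y b})),
    fun k => (hW k).image_comp f,
    fun k => ((hV k).inter (hb0.inter hbe)).image_comp h.divisible f b hf hb hfb, fun x => ?_⟩
  constructor
  · rintro ⟨y, hy, rfl⟩
    obtain ⟨k, hk, hk'⟩ := (hX y).1 hy
    exact ⟨k, ⟨_, hk, rfl⟩, _, ⟨hk', h.fract_nonneg _, sub_pos.2 (h.fract_lt _)⟩, rfl⟩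
  · rintro ⟨k, ⟨w, hw, hwx⟩, r, ⟨hr, hr0, hre⟩, hrx⟩
    have hr' : ∀ i, 0 ≤ r i ∧ r i < e := by
      intro i
      rcases hfb i with rfl | ⟨j, rfl⟩
      · exact ⟨hr0, sub_pos.1 hre⟩
      · have : r (f j) = h.fract (x j) := congrFun hrx j
        rw [this]
        exact ⟨h.fract_nonneg _, h.fract_lt _⟩
    refine ⟨fun i => w i + r i, (hX _).2 ⟨k, ?_, ?_⟩, ?_⟩
    · convert hw using 1
      exact funext fun i => h.floor_add _ (hr' i).1 (hr' i).2
    · convert hr using 1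
      exact funext fun i => h.fract_add _ (hr' i).1 (hr' i).2
    · funext j
      have h₁ : w (f j) = h.floor (x j) := congrFun hwx j
      have h₂ : r (f j) = h.fract (x j) := congrFun hrx j
      simp only [Function.comp_apply, h₁, h₂, h.floor_add_fract]

/-- Terms split into an integral term in the integer parts and an affine function of the
fractional parts. -/
theorem exists_term_decomposition (t : LAddOrdPred.Term γ) (a : (β → M) → γ → M)
    (ha : ∀ i, (∃ c, ∀ x, a x i = c) ∨ ∃ j, ∀ x, a x i = x j) :
    letI := addOrdPredStructure M (S : Set M)
    ∃ (t' : LAddOrd.Term ((Set.univ : Set S) ⊕ β)) (g : (β → M) → M) (n : ℕ), IsAffine g ∧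
      ∀ x, t.realize (a x) =
          (t'.realize (Sum.elim (↑) (h.floor ∘ x)) : S) + g (h.fract ∘ x) ∧
        0 ≤ g (h.fract ∘ x) ∧ g (h.fract ∘ x) < n • e := by
  let := addOrdPredStructure M (S : Set M)
  induction t with
  | var i =>
    rcases ha i with ⟨c, hc⟩ | ⟨j, hj⟩
    · refine ⟨Term.var (Sum.inl ⟨h.floor c, trivial⟩), fun _ => h.fract c, 1, .const _,
        fun x => ⟨?_, h.fract_nonneg c, ?_⟩⟩
      · simp [hc, h.floor_add_fract]
      · simpa using h.fract_lt c
    · refine ⟨Term.var (Sum.inr j), fun x => x j, 1, .proj _,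
        fun x => ⟨?_, h.fract_nonneg _, ?_⟩⟩
      · simp [hj, h.floor_add_fract]
      · simpa using h.fract_lt _
  | func f ts ih =>
    cases f
    obtain ⟨t₁, g₁, n₁, hg₁, h₁⟩ := ih 0
    obtain ⟨t₂, g₂, n₂, hg₂, h₂⟩ := ih 1
    refine ⟨Functions.apply₂ (L := LAddOrd) AddFunc.add t₁ t₂, _, n₁ + n₂, hg₁.add hg₂,
      fun x => ⟨?_, add_nonneg (h₁ x).2.1 (h₂ x).2.1, ?_⟩⟩
    · change (ts 0).realize (a x) + (ts 1).realize (a x) =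
        ((t₁.realize (Sum.elim (↑) (h.floor ∘ x)) + t₂.realize (Sum.elim (↑) (h.floor ∘ x)) : S) :
          M) + _
      rw [(h₁ x).1, (h₂ x).1, AddMemClass.coe_add]
      abel
    · rw [add_nsmul]
      exact add_lt_add (h₁ x).2.2 (h₂ x).2.2

theorem isDecomposable_term_lt (t s : LAddOrdPred.Term γ) (a : (β → M) → γ → M)
    (ha : ∀ i, (∃ c, ∀ x, a x i = c) ∨ ∃ j, ∀ x, a x i = x j) :
    letI := addOrdPredStructure M (S : Set M)
    h.IsDecomposable {x | t.realize (a x) < s.realize (a x)} := by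
  let := addOrdPredStructure M (S : Set M)
  obtain ⟨t', g, n, hg, ht⟩ := h.exists_term_decomposition t a ha
  obtain ⟨s', g', n', hg', hs⟩ := h.exists_term_decomposition s a ha
  let c : ℕ → LAddOrd.Term ((Set.univ : Set S) ⊕ β) := fun i =>
    Term.var (Sum.inl ⟨⟨i • e, h.nsmul_mem i⟩, trivial⟩)
  -- The shift by `n' • e` makes `d` nonnegative, so its integer part is one of `0, …, n + n' - 1`
  -- times `e`.
  let d : (β → M) → M := fun r => g r - g' r + n' • e
  have hd : IsAffine d := (hg.sub hg').add (.const _)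
  have hW := fun i : ℕ => definable_term_lt
    (Functions.apply₂ (L := LAddOrd) AddFunc.add t' (c i))
    (Functions.apply₂ (L := LAddOrd) AddFunc.add s' (c n'))
  have hV₁ : ∀ i : ℕ, IsSemilinear {r | 0 ≤ d r - i • e} := fun i =>
    (hd.sub (.const _)).isSemilinear_nonneg
  have hV₂ : ∀ i : ℕ, IsSemilinear {r | 0 < (i + 1) • e - d r} := fun i =>
    (IsAffine.sub (.const _) hd).isSemilinear_pos
  refine ⟨Fin (n + n'), inferInstance, _, _, fun i => hW i,
    fun i => (hV₁ i).inter (hV₂ i), fun x => ?_⟩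
  obtain ⟨ht₁, ht₂, ht₃⟩ := ht x
  obtain ⟨hs₁, hs₂, hs₃⟩ := hs x
  have hd0 : 0 ≤ d (h.fract ∘ x) := by
    have : d (h.fract ∘ x) = g (h.fract ∘ x) + (n' • e - g' (h.fract ∘ x)) := by
      simp only [d]
      abel
    rw [this]
    exact add_nonneg ht₂ (sub_nonneg.2 hs₃.le)
  have hdn : d (h.fract ∘ x) < (n + n') • e := by
    rw [add_nsmul]
    have : g (h.fract ∘ x) - g' (h.fract ∘ x) < n • e := (sub_le_self _ hs₂).trans_lt ht₃
    exact add_lt_add_left this _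
  have hlt : t.realize (a x) < s.realize (a x) ↔
      (t'.realize (Sum.elim (↑) (h.floor ∘ x)) : S) + d (h.fract ∘ x) <
        (s'.realize (Sum.elim (↑) (h.floor ∘ x)) : S) + n' • e := by
    rw [ht₁, hs₁, ← sub_pos, ← sub_pos (b := _ + d _)]
    refine iff_of_eq (congrArg _ ?_)
    simp only [d]
    abel
  -- A strict inequality between elements of `S` leaves a gap of at least `e`, so `d` may be
  -- replaced by its integer part `i • e`.
  have hWi : ∀ i : ℕ, i • e ≤ d (h.fract ∘ x) → d (h.fract ∘ x) < (i + 1) • e →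
      ((t'.realize (Sum.elim (↑) (h.floor ∘ x)) : S) + d (h.fract ∘ x) <
        (s'.realize (Sum.elim (↑) (h.floor ∘ x)) : S) + n' • e ↔
      (t'.realize (Sum.elim (↑) (h.floor ∘ x)) : S) + i • e <
        ((s'.realize (Sum.elim (↑) (h.floor ∘ x)) : S) : M) + n' • e) := by
    intro i hi hi'
    refine ⟨fun hlt => (add_le_add_right hi _).trans_lt hlt, fun hlt => ?_⟩
    have := h.add_one_le (S.add_mem (Subtype.property _) (h.nsmul_mem i))
      (S.add_mem (Subtype.property _) (h.nsmul_mem n')) hlt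
    rw [add_assoc, ← succ_nsmul] at this
    exact (add_lt_add_right hi' _).trans_le this
  change t.realize (a x) < s.realize (a x) ↔ ∃ i : Fin (n + n'),
    (t'.realize (Sum.elim (↑) (h.floor ∘ x)) : S) + (i : ℕ) • e <
        ((s'.realize (Sum.elim (↑) (h.floor ∘ x)) : S) : M) + n' • e ∧
    0 ≤ d (h.fract ∘ x) - (i : ℕ) • e ∧ 0 < ((i : ℕ) + 1) • e - d (h.fract ∘ x)
  simp only [sub_nonneg, sub_pos]
  rw [hlt]
  constructor
  · intro hx
    obtain ⟨i, hin, hi, hi'⟩ := exists_nsmul_le_lt _ hd0 hdn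
    exact ⟨⟨i, hin⟩, (hWi i hi hi').1 hx, hi, hi'⟩
  · rintro ⟨i, hx, hi, hi'⟩
    exact (hWi i hi hi').2 hx

/-- Only the fractional contribution matters, and it lies in `S` exactly when it is one of finitely
many multiples of `e`. -/
theorem isDecomposable_term_mem (t : LAddOrdPred.Term γ) (a : (β → M) → γ → M)
    (ha : ∀ i, (∃ c, ∀ x, a x i = c) ∨ ∃ j, ∀ x, a x i = x j) :
    letI := addOrdPredStructure M (S : Set M)
    h.IsDecomposable {x | t.realize (a x) ∈ S} := by
  let := addOrdPredStructure M (S : Set M)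
  obtain ⟨t', g, n, hg, ht⟩ := h.exists_term_decomposition t a ha
  have : {x | t.realize (a x) ∈ S} =
      ⋃ i : Fin n, {x | h.fract ∘ x ∈ {r | g r - (i : ℕ) • e = 0}} := by
    ext x
    obtain ⟨ht₁, ht₂, ht₃⟩ := ht x
    simp only [Set.mem_ofPred_eq, Set.mem_iUnion, ht₁]
    constructor
    · intro hx
      obtain ⟨i, hin, hi, hi'⟩ := exists_nsmul_le_lt _ ht₂ ht₃
      refine ⟨⟨i, hin⟩, sub_eq_zero.2 (le_antisymm (not_lt.1 fun hlt => ?_) hi)⟩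
      have hg' : g (h.fract ∘ x) ∈ S := by
        simpa using h.sub_mem hx (Subtype.property (t'.realize (Sum.elim (↑) (h.floor ∘ x))))
      have := h.add_one_le (h.nsmul_mem i) hg' hlt
      rw [← succ_nsmul] at this
      exact this.not_gt hi'
    · rintro ⟨i, hi⟩
      rw [sub_eq_zero.1 hi]
      exact S.add_mem (Subtype.property _) (h.nsmul_mem i)
  rw [this]
  exact IsDecomposable.iUnion h fun i =>
    h.isDecomposable_fract (hg.sub (.const _)).isSemilinear_eq_zero

/-- Definable sets are decomposable. -/
theorem isDecomposable_realize {n m : ℕ}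
    (φ : LAddOrdPred.BoundedFormula ((Set.univ : Set M) ⊕ Fin m) n) :
    letI := addOrdPredStructure M (S : Set M)
    h.IsDecomposable {x : Fin m ⊕ Fin n → M |
      φ.Realize (Sum.elim (↑) (x ∘ Sum.inl)) (x ∘ Sum.inr)} := by
  let := addOrdPredStructure M (S : Set M)
  have ha : ∀ (n : ℕ) (i : ((Set.univ : Set M) ⊕ Fin m) ⊕ Fin n),
      (∃ c, ∀ x : Fin m ⊕ Fin n → M, parameterAssignment x i = c) ∨
      ∃ j, ∀ x : Fin m ⊕ Fin n → M, parameterAssignment x i = x j := by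
    rintro n ((c | i) | i)
    · exact Or.inl ⟨c, fun _ => rfl⟩
    · exact Or.inr ⟨Sum.inl i, fun _ => rfl⟩
    · exact Or.inr ⟨Sum.inr i, fun _ => rfl⟩
  induction φ with
  | falsum => exact h.isDecomposable_empty
  | @equal n t s =>
    have h₁ := (h.isDecomposable_term_lt t s parameterAssignment (ha n)).compl h
    have h₂ := (h.isDecomposable_term_lt s t parameterAssignment (ha n)).compl h
    convert h₁.inter h h₂ using 1
    ext x
    simp only [Set.mem_inter_iff, Set.mem_compl_iff, Set.mem_ofPred_eq, not_lt]
    exact ⟨fun hx => ⟨hx.ge, hx.le⟩, fun hx => le_antisymm hx.2 hx.1⟩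
  | @rel n l R ts =>
    cases R with
    | lt => exact h.isDecomposable_term_lt (ts 0) (ts 1) parameterAssignment (ha n)
    | pred => exact h.isDecomposable_term_mem (ts 0) parameterAssignment (ha n)
  | imp φ ψ ihφ ihψ =>
    convert (ihφ.compl h).union h ihψ using 1
    ext x
    simp only [BoundedFormula.realize_imp, Set.mem_union, Set.mem_compl_iff, Set.mem_ofPred_eq]
    exact imp_iff_not_or
  | @all n φ ih =>
    -- `∀` is `¬∃¬`; the projection forgets the last bound variable.
    have := (ih.compl h).image_comp h (Sum.map id Fin.castSucc) (Sum.inr (Fin.last n))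
      (Function.injective_id.sumMap (Fin.castSucc_injective n)) (by
        rintro ⟨i | i, hi⟩
        · simp at hi
        · exact (Fin.castSucc_ne_last i) (Sum.inr_injective hi)) (by
        rintro (i | i)
        · exact Or.inr ⟨Sum.inl i, rfl⟩
        · refine Fin.lastCases (Or.inl rfl) (fun j => Or.inr ⟨Sum.inr j, rfl⟩) i)
    convert this.compl h using 1
    ext x
    simp only [BoundedFormula.realize_all, Set.mem_compl_iff, Set.mem_image, Set.mem_ofPred_eq,
      not_exists, not_and]
    constructor
    · rintro hx y hy rfl
      refine hy ?_
      exact (iff_of_eq (congrArg₂ φ.Realize rfl (Fin.snoc_init_self (y ∘ Sum.inr)))).1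
        (hx (y (Sum.inr (Fin.last n))))
    · intro hx t
      by_contra hn
      refine hx (Sum.elim (x ∘ Sum.inl) (Fin.snoc (x ∘ Sum.inr) t)) hn ?_
      ext (i | i) <;> simp

end HasIntegerPart

end Decomposition

/-! ### Points and intervals on the line. -/

/-- A set depending only on the position relative to finitely many points is, inside `[o, e)`,
a finite union of points and open intervals. -/
theorem exists_finite_points_intervals {N : Type*} [LinearOrder N] {o e : N} (hoe : o < e)
    {V P : Set N} (hP : P.Finite)
    (hV : ∀ x y, (∀ p ∈ P, (p < x ↔ p < y) ∧ (x < p ↔ y < p)) → x ∈ V → y ∈ V) :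
    ∃ Q : Set (Set N), Q.Finite ∧
      (∀ q ∈ Q, (∃ p, o ≤ p ∧ p < e ∧ q = {p}) ∨
        ∃ a b, a < b ∧ o ≤ a ∧ b ≤ e ∧ q = Set.Ioo a b) ∧
      ∀ x, o ≤ x → x < e → (x ∈ V ↔ ∃ q ∈ Q, x ∈ q) := by
  -- Adding the endpoints guarantees a neighbour in `P'` on each side of any other point of `[o,
  -- e)`.
  let P' : Set N := insert o (insert e P) ∩ Set.Icc o e
  have hP' : P'.Finite := ((hP.insert e).insert o).inter_of_left _
  refine ⟨{q | q ⊆ V ∧ ((∃ p ∈ P', p < e ∧ q = {p}) ∨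
    ∃ a ∈ P', ∃ b ∈ P', a < b ∧ q = Set.Ioo a b)}, ?_, ?_, ?_⟩
  · refine ((hP'.image fun p => {p}).union (hP'.image2 Set.Ioo hP')).subset ?_
    rintro q ⟨-, ⟨p, hp, -, rfl⟩ | ⟨a, ha, b, hb, -, rfl⟩⟩
    · exact Or.inl ⟨p, hp, rfl⟩
    · exact Or.inr ⟨a, ha, b, hb, rfl⟩
  · rintro q ⟨-, ⟨p, hp, hpe, rfl⟩ | ⟨a, ha, b, hb, hab, rfl⟩⟩
    · exact Or.inl ⟨p, hp.2.1, hpe, rfl⟩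
    · exact Or.inr ⟨a, b, hab, ha.2.1, hb.2.2, rfl⟩
  · intro x hox hxe
    refine ⟨fun hx => ?_, fun ⟨q, hq, hxq⟩ => hq.1 hxq⟩
    by_cases hxP : x ∈ P'
    · exact ⟨{x}, ⟨by simpa using hx, Or.inl ⟨x, hxP, hxe, rfl⟩⟩, rfl⟩
    have hoP : o ∈ P' := ⟨by simp, le_rfl, hoe.le⟩
    have heP : e ∈ P' := ⟨by simp, hoe.le, le_rfl⟩
    have hox' : o < x := lt_of_le_of_ne hox fun h => hxP (h ▸ hoP)
    -- The neighbours `a` and `b` of `x` in `P'` bound an interval on which the position relative to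
    -- all of `P` is constant.
    obtain ⟨a, ⟨ha, hax⟩, hamax⟩ := (hP'.inter_of_left (Set.Iio x)).exists_maximal ⟨o, hoP, hox'⟩
    obtain ⟨b, ⟨hb, hxb⟩, hbmin⟩ := (hP'.inter_of_left (Set.Ioi x)).exists_minimal ⟨e, heP, hxe⟩
    simp only [Set.mem_Iio, Set.mem_Ioi] at hax hxb
    have ha' : ∀ p ∈ P', p < x → p ≤ a := fun p hp hpx =>
      (le_total p a).elim id fun h => hamax ⟨hp, hpx⟩ h
    have hb' : ∀ p ∈ P', x < p → b ≤ p := fun p hp hpx =>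
      (le_total b p).elim id fun h => hbmin ⟨hp, hpx⟩ h
    refine ⟨Set.Ioo a b, ⟨fun y hy => hV x y (fun p hp => ?_) hx,
      Or.inr ⟨a, ha, b, hb, hax.trans hxb, rfl⟩⟩, hax, hxb⟩
    rcases lt_or_ge p o with hpo | hpo
    · have h₁ : p < x := hpo.trans hox'
      have h₂ : p < y := hpo.trans_le (ha.2.1.trans hy.1.le)
      simp [h₁, h₂, h₁.not_gt, h₂.not_gt]
    rcases lt_or_ge e p with hpe | hpe
    · have h₁ : x < p := hxe.trans hpe
      have h₂ : y < p := (hy.2.le.trans hb.2.2).trans_lt hpe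
      simp [h₁, h₂, h₁.not_gt, h₂.not_gt]
    have hpP : p ∈ P' := ⟨by simp [hp], hpo, hpe⟩
    rcases lt_trichotomy p x with h₁ | rfl | h₁
    · have h₂ : p < y := (ha' p hpP h₁).trans_lt hy.1
      simp [h₁, h₂, h₁.not_gt, h₂.not_gt]
    · exact absurd hpP hxP
    · have h₂ : y < p := hy.2.trans_le (hb' p hpP h₁)
      simp [h₁, h₂, h₁.not_gt, h₂.not_gt]

section Decomposition

variable {M : Type u} [AddCommGroup M] [LinearOrder M] [IsOrderedAddMonoid M]

namespace HasIntegerPart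

variable {S : AddSubsemigroup M} {e : M}

/-- Definable subsets of the line are finite unions of sets of elements with integer part in a
definable set and fractional part in a semilinear set. -/
theorem exists_decomposition (h : HasIntegerPart S e) {X : Set M}
    (hX : DefinableAddOrdPred (S : Set M) X) :
    ∃ (K : Type) (_ : Finite K) (W : K → Set S) (V : K → Set (Fin 1 ⊕ Fin 0 → M)),
      (∀ k, DefinableAddOrd (W k)) ∧ (∀ k, IsSemilinear (V k)) ∧
      ∀ x, x ∈ X ↔ ∃ k, h.floor x ∈ W k ∧ (fun _ => h.fract x) ∈ V k := by
  let := addOrdPredStructure M (S : Set M)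
  obtain ⟨φ, hφ⟩ := Set.definable_iff_exists_formula_sum.1 hX
  obtain ⟨K, hK, W, V, hW, hV, hWV⟩ := h.isDecomposable_realize φ
  refine ⟨K, hK, fun k => {s | (fun _ => s) ∈ W k}, V, fun k => ?_, hV, fun x => ?_⟩
  · exact (hW k).preimage_comp (fun _ => (0 : Fin 1))
  · have h₁ : x ∈ X ↔ (fun _ : Fin 1 => x) ∈ {v : Fin 1 → M | v 0 ∈ X} := Iff.rfl
    have h₂ := hWV fun _ => x
    have h₃ : (fun _ : Fin 1 => x) ∈ {v : Fin 1 → M | φ.Realize (Sum.elim (↑) v)} ↔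
        φ.Realize (Sum.elim Subtype.val fun _ : Fin 1 => x) := Iff.rfl
    have h₄ : (fun _ : Fin 0 => x) = default := Subsingleton.elim _ _
    have hφ' : {v : Fin 1 → M | v 0 ∈ X} = {v | φ.Realize (Sum.elim (↑) v)} := hφ
    rw [h₁, hφ', h₃, Formula.Realize, ← h₄]
    exact h₂

theorem exists_translates (h : HasIntegerPart S e) {X : Set M}
    (hX : DefinableAddOrdPred (S : Set M) X) :
    ∃ F : Set (Set M), F.Finite ∧ X = ⋃₀ F ∧
      ∀ Y ∈ F, IsTranslatePoints S 0 e Y ∨ IsTranslateIntervals S 0 e Y := by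
  obtain ⟨K, hK, W, V, hW, hV, hX⟩ := h.exists_decomposition hX
  have key : ∀ k, ∃ Q : Set (Set M), Q.Finite ∧
      (∀ q ∈ Q, (∃ p, 0 ≤ p ∧ p < e ∧ q = {p}) ∨
        ∃ a b, a < b ∧ 0 ≤ a ∧ b ≤ e ∧ q = Set.Ioo a b) ∧
      ∀ x, 0 ≤ x → x < e → ((fun _ => x) ∈ V k ↔ ∃ q ∈ Q, x ∈ q) := by
    intro k
    obtain ⟨P, hP, hPV⟩ := (hV k).exists_finite_breakpoints h.divisible (Sum.inl 0) (by
      rintro (i | i)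
      · rw [Subsingleton.elim i 0]
      · exact i.elim0)
    exact exists_finite_points_intervals h.one_pos (V := {x | (fun _ => x) ∈ V k}) hP
      fun x y hxy => (hPV _ _ hxy).1
  choose Q hQ hQ' hQV using key
  refine ⟨⋃ k, (fun q => {x | ∃ w ∈ W k, ∃ r ∈ q, x = (w : M) + r}) '' Q k,
    Set.finite_iUnion fun k => (hQ k).image _, ?_, ?_⟩
  · ext x
    simp only [Set.mem_sUnion, Set.mem_iUnion, Set.mem_image]
    rw [hX]
    constructor
    · rintro ⟨k, hk, hk'⟩
      obtain ⟨q, hq, hxq⟩ := (hQV k _ (h.fract_nonneg x) (h.fract_lt x)).1 hk'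
      exact ⟨_, ⟨k, q, hq, rfl⟩, h.floor x, hk, _, hxq, (h.floor_add_fract x).symm⟩
    · rintro ⟨_, ⟨k, q, hq, rfl⟩, w, hw, r, hr, rfl⟩
      have hr' : 0 ≤ r ∧ r < e := by
        rcases hQ' k q hq with ⟨p, h₀, h₁, rfl⟩ | ⟨a, b, -, h₀, h₁, rfl⟩
        · rw [Set.mem_singleton_iff.1 hr]
          exact ⟨h₀, h₁⟩
        · exact ⟨h₀.trans hr.1.le, hr.2.trans_le h₁⟩
      refine ⟨k, ?_, ?_⟩
      · rwa [h.floor_add w hr'.1 hr'.2]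
      · rw [h.fract_add w hr'.1 hr'.2]
        exact (hQV k r hr'.1 hr'.2).2 ⟨q, hq, hr⟩
  · intro Y hY
    obtain ⟨k, q, hq, rfl⟩ := Set.mem_iUnion.1 hY
    rcases hQ' k q hq with ⟨p, h₀, h₁, rfl⟩ | ⟨a, b, hab, h₀, h₁, rfl⟩
    · refine Or.inl ⟨W k, p, hW k, h₀.eq_or_lt, h₁, ?_⟩
      ext x
      simp
    · refine Or.inr ⟨W k, a, b, hW k, hab, h₀.eq_or_lt, (hab.trans_le h₁).le.eq_or_lt,
        (h₀.trans_lt hab).le.eq_or_lt, h₁.eq_or_lt, ?_⟩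
      ext x
      simp only [Set.mem_iUnion, Set.mem_ofPred_eq, exists_prop]
      refine exists_congr fun w => and_congr_right fun _ => ?_
      constructor
      · rintro ⟨r, hr, rfl⟩
        exact ⟨by simpa using hr.1, by simpa using hr.2⟩
      · rintro ⟨hx, hx'⟩
        exact ⟨x - w, ⟨lt_sub_iff_add_lt'.2 hx, sub_lt_iff_lt_add'.2 hx'⟩, by abel⟩

end HasIntegerPart

end Decomposition

/-! ### From the axioms to an ordered group. -/

namespace IntegerPartAxioms

variable {M : Type u} [Add M] [LT M] {Z : Set M} {o e : M}

/-- The group structure given by the axioms. -/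
@[reducible] noncomputable def addCommGroup (h : IntegerPartAxioms M Z o e) :
    AddCommGroup M where
  add := (· + ·)
  zero := o
  neg x := (h.exists_neg x).choose
  add_assoc := h.assoc
  zero_add := h.zero_add
  add_zero x := (h.comm x o).trans (h.zero_add x)
  add_comm := h.comm
  neg_add_cancel x := (h.comm _ x).trans (h.exists_neg x).choose_spec
  nsmul := @nsmulRec M ⟨o⟩ ⟨(· + ·)⟩
  zsmul := @zsmulRec M ⟨o⟩ ⟨(· + ·)⟩ ⟨fun x => (h.exists_neg x).choose⟩
    (@nsmulRec M ⟨o⟩ ⟨(· + ·)⟩)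

/-- The linear order given by the axioms. -/
@[reducible] noncomputable def linearOrder (h : IntegerPartAxioms M Z o e) :
    LinearOrder M where
  lt := (· < ·)
  le x y := x = y ∨ x < y
  le_refl _ := Or.inl rfl
  le_trans x y z hxy hyz := by
    rcases hxy with rfl | hxy
    · exact hyz
    · rcases hyz with rfl | hyz
      · exact Or.inr hxy
      · exact Or.inr (h.trans x y z hxy hyz)
  lt_iff_le_not_ge x y := by
    constructor
    · intro hxy
      refine ⟨Or.inr hxy, ?_⟩
      rintro (rfl | hyx)
      · exact h.irrefl _ hxy
      · exact h.irrefl _ (h.trans _ _ _ hxy hyx)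
    · rintro ⟨rfl | hxy, hyx⟩
      · exact absurd (Or.inl rfl) hyx
      · exact hxy
  le_antisymm x y hxy hyx := by
    rcases hxy with rfl | hxy
    · rfl
    · rcases hyx with rfl | hyx
      · rfl
      · exact absurd (h.trans _ _ _ hxy hyx) (h.irrefl _)
  le_total x y := by
    rcases h.total x y with hxy | rfl | hxy
    · exact Or.inl (Or.inr hxy)
    · exact Or.inl (Or.inl rfl)
    · exact Or.inr (Or.inr hxy)
  toDecidableLE := Classical.decRel _

/-- The set `Z` as a subsemigroup. -/
def addSubsemigroup (h : IntegerPartAxioms M Z o e) : AddSubsemigroup M where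
  carrier := Z
  add_mem' hx hy := h.add_mem _ _ hx hy

theorem exists_translates (h : IntegerPartAxioms M Z o e)
    (hdiv : ∀ (n : ℕ) (x : M), ∃ y : M, addMultiple y n = x) (X : Set M)
    (hX : DefinableAddOrdPred Z X) :
    ∃ F : Set (Set M), F.Finite ∧ X = ⋃₀ F ∧
      ∀ Y ∈ F, IsTranslatePoints h.addSubsemigroup o e Y ∨
        IsTranslateIntervals h.addSubsemigroup o e Y := by
  let iG := h.addCommGroup
  let iL := h.linearOrder
  have iO : IsOrderedAddMonoid M := by
    refine { add_le_add_left := fun a b hab c => ?_ }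
    rcases hab with rfl | hab
    · exact Or.inl rfl
    · exact Or.inr (h.add_lt _ _ _ hab)
  have hI : HasIntegerPart (M := M) h.addSubsemigroup e := by
    refine ⟨h.zero_mem, fun z hz => h.neg_mem z _ hz (h.exists_neg z).choose_spec, h.one_mem,
      h.zero_lt_one, h.least, fun x => ?_, fun n x hn => ?_⟩
    · obtain ⟨z, hz, hzx, hxz⟩ := h.exists_floor x
      exact ⟨z, hz, not_lt.1 hzx, hxz⟩
    -- `addMultiple y k` has `k + 1` summands, hence the predecessor of `|n|`.
    · obtain ⟨k, hk⟩ := Nat.exists_eq_succ_of_ne_zero (Int.natAbs_ne_zero.2 hn)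
      obtain ⟨y, hy⟩ := hdiv k x
      have hy' : (n.natAbs : ℤ) • y = x := by
        rw [hk, natCast_zsmul, ← hy]
        exact (addMultiple_eq_nsmul y k).symm
      rcases Int.natAbs_eq n with hn' | hn'
      · exact ⟨y, by rw [hn', hy']⟩
      · exact ⟨-y, by rw [hn', neg_zsmul, zsmul_neg, neg_neg, hy']⟩
  -- `hX` applies unchanged because the constructed group and order have the original `+` and `<`
  -- definitionally.
  exact hI.exists_translates hX

end IntegerPartAxioms

theorem mainTheorem12 (M : Type u) [Add M] [LT M] (Z : Set M) (hM : ModelsRealInt M Z) :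
    ∃ (o e : M) (S : AddSubsemigroup M),
      IsNeutral o ∧ IsLeastAbove Z o e ∧ (S : Set M) = Z ∧
      ∀ X : Set M, DefinableAddOrdPred Z X →
        ∃ F : Set (Set M), F.Finite ∧ X = ⋃₀ F ∧
          ∀ Y ∈ F, IsTranslatePoints S o e Y ∨ IsTranslateIntervals S o e Y := by
  obtain ⟨o, e, h⟩ := hM.exists_integerPartAxioms
  exact ⟨o, e, h.addSubsemigroup,
    fun x => ⟨h.zero_add x, (h.comm x o).trans (h.zero_add x)⟩,
    ⟨h.one_mem, h.zero_lt_one, h.least⟩, rfl,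
    h.exists_translates hM.exists_addMultiple_eq⟩
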